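/- For a positive integer $n$, an exact $r$-coloring of $\mathbb{Z}_n=\mathbb{Z}/n\mathbb{Z}$ is a surjective function $c:\mathbb{Z}_n\to\{1,\dots,r\}$. A rainbow solution, under $c$, to the Sidon equation $S$: $x_1+x_2=x_3+x_4$ is a solution $(x_1,x_2,x_3,x_4)\in\mathbb{Z}_n^4$ such that $c(x_1),c(x_2),c(x_3),c(x_4)$ are pairwise distinct. Let $\mathrm{rb}(\mathbb{Z}_n,S)$ be the smallest positive integer $r$ such that every exact $r$-coloring of $\mathbb{Z}_n$ has a rainbow solution to $S$, with $\mathrm{rb}(\mathbb{Z}_n,S)=n+1$ if no $r\le n$ has this property. Theorem. Let $n\ge 2$ be an integer with prime factorization $n=p_1p_2\cdots p_k$, where $p_1\le p_2\le\cdots\le p_k$ are primes listed with multiplicity. Let $m$ be the smallest index such that $p_m\ge 3$, or $m=k$ if there is no such index. Let $f_1$ be the number of indices $i\neq m$ with $p_i\le 3$, and $f_2$ the number of indices $i\ne m$ with $p_i\ge 5$. Then $$\mathrm{rb}(\mathbb{Z}_n,S)=\mathrm{rb}(\mathbb{Z}_{p_m},S)+f_1+2f_2.$$ -/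

import Mathlib

/-- A coloring `c` of `ℤ/n` with color set `[r]` has a rainbow solution to the equation in `k`
unknowns whose set of solutions in `ℤ/n` is `eq`: some solution has entries with pairwise
different colors. -/
def HasRainbowSolution {n k r : ℕ} (eq : Set (Fin k → ZMod n)) (c : ZMod n → Fin r) : Prop :=
  ∃ x ∈ eq, Function.Injective fun i => c (x i)

/-- The rainbow number of `ℤ/n` for an equation (given by its set of solutions `eq`): the smallest
positive integer `r` such that every exact (that is, surjective) `r`-coloring of `ℤ/n` has a rainbow
solution. For `n ≥ 1` there is no exact `(n + 1)`-coloring, so `r = n + 1` always qualifies: this is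
the convention that the rainbow number is `n + 1` if no `r ≤ n` forces a rainbow solution. -/
noncomputable def rainbowNumber (n : ℕ) {k : ℕ} (eq : Set (Fin k → ZMod n)) : ℕ :=
  sInf {r : ℕ | 0 < r ∧
    ∀ c : ZMod n → Fin r, Function.Surjective c → HasRainbowSolution eq c}

/-- The solutions in `ℤ/n` of the Sidon equation `x₁ + x₂ = x₃ + x₄`. -/
def sidonEquation (n : ℕ) : Set (Fin 4 → ZMod n) :=
  {x | x 0 + x 1 = x 2 + x 3}

/-! Let M(G) be the largest number of colors in a rainbow-free coloring of G. Merging colors keeps a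
coloring rainbow-free, so the rainbow number is M + 1. The theorem amounts to M(ℤ/n) = 1 + ∑ w(q) +
[3 ∣ n], summed over the prime factors q of n with multiplicity, where w(q) = 1 for q ≤ 3 and w(q) =
2 otherwise. The term [3 ∣ n] reflects that ℤ/3 has too few elements for a rainbow solution; since
p_m = 3 exactly when 3 ∣ n, it is absorbed into the rainbow number of p_m.

Upper bound: for an extension G of Q by N, M(G) ≤ M(N) + M(Q) - 1 (`ColorBound.extension`). Relative
to a fiber with the most colors, every fiber has at most one new color, and recording it (or `none`)
gives a rainbow-free coloring of Q. This is too weak for repeated factors 3, so powers of 3 are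
treated separately (`colorBound_three_pow`). For p ≥ 5, M(ℤ/p) ≤ 3 (`colorBound_prime`): four colors
would split the nonzero differences into three classes such that a sum across two classes stays in
their union, and an isoperimetric argument based on Cauchy-Davenport excludes this.

Lower bound: keep an optimal coloring on a subgroup and give its complement w(q) new colors,
symmetrically under negation (`HasColoring.extension`). -/

/-- A coloring is rainbow-free if no solution of `a + b = x + y` has four distinct colors. -/
def RainbowFree {G κ : Type} [Add G] (c : G → κ) : Prop :=
  ∀ a b x y, a + b = x + y → c a ≠ c b → c a ≠ c x → c a ≠ c y → c b ≠ c x → c b ≠ c y →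
    c x ≠ c y → False

/-- Every rainbow-free coloring of `G` uses at most `r` colors. -/
def ColorBound (G : Type) [Add G] (r : ℕ) : Prop :=
  ∀ (κ : Type) (c : G → κ), RainbowFree c → (Set.range c).ncard ≤ r

/-- Some rainbow-free coloring of `G` uses at least `r` colors. -/
def HasColoring (G : Type) [Add G] (r : ℕ) : Prop :=
  ∃ (κ : Type) (c : G → κ), RainbowFree c ∧ r ≤ (Set.range c).ncard

theorem RainbowFree.comp {G κ μ : Type} [Add G] {c : G → κ} (hc : RainbowFree c) (f : κ → μ) :
    RainbowFree (f ∘ c) := fun a b x y h h1 h2 h3 h4 h5 h6 =>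
  hc a b x y h (fun e => h1 (congrArg f e)) (fun e => h2 (congrArg f e))
    (fun e => h3 (congrArg f e)) (fun e => h4 (congrArg f e)) (fun e => h5 (congrArg f e))
    (fun e => h6 (congrArg f e))

theorem RainbowFree.comp_hom {G N κ : Type} [AddCommGroup G] [AddCommGroup N] {c : G → κ}
    (hc : RainbowFree c) (f : N →+ G) (g : G) : RainbowFree fun n => c (g + f n) := by
  intro a b x y h
  refine hc _ _ _ _ ?_
  have := congrArg f h
  simp only [map_add] at this
  calc g + f a + (g + f b) = g + g + (f a + f b) := by abel
    _ = g + g + (f x + f y) := by rw [this]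
    _ = _ := by abel

theorem colorBound_card (G : Type) [Add G] [Finite G] : ColorBound G (Nat.card G) := by
  intro κ c _
  rw [← Set.image_univ, ← Set.ncard_univ]
  exact Set.ncard_image_le

theorem ZMod.exists_exact (n m : ℕ) [NeZero n] [NeZero m] :
    ∃ (ι : ZMod n →+ ZMod (n * m)) (π : ZMod (n * m) →+ ZMod m),
      Function.Injective ι ∧ Function.Surjective π ∧ Function.Exact ι π := by
  have hm : (m : ℤ) ≠ 0 := by exact_mod_cast NeZero.ne m
  let f : ℤ →+ ZMod (n * m) := zmultiplesHom _ (m : ZMod (n * m))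
  have hfk : ∀ k : ℤ, f k = ((k * m : ℤ) : ZMod (n * m)) := by
    intro k; simp [f]
  have hf : f n = 0 := by
    rw [hfk, ZMod.intCast_zmod_eq_zero_iff_dvd]; simp
  refine ⟨ZMod.lift n ⟨f, hf⟩, (ZMod.castHom (dvd_mul_left m n) (ZMod m)).toAddMonoidHom,
    ?_, ?_, ?_⟩
  · rw [ZMod.lift_injective]
    intro k hk
    have hk' : f k = 0 := hk
    rw [hfk, ZMod.intCast_zmod_eq_zero_iff_dvd] at hk'
    rw [ZMod.intCast_zmod_eq_zero_iff_dvd]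
    push_cast at hk'
    exact (mul_dvd_mul_iff_right hm).1 hk'
  · exact ZMod.castHom_surjective (dvd_mul_left m n)
  · intro y
    obtain ⟨y, rfl⟩ := ZMod.intCast_surjective y
    have : ((ZMod.castHom (dvd_mul_left m n) (ZMod m)).toAddMonoidHom (y : ZMod (n * m)))
        = (y : ZMod m) := by simp
    rw [this, ZMod.intCast_zmod_eq_zero_iff_dvd]
    constructor
    · rintro ⟨t, rfl⟩
      refine ⟨(t : ZMod n), ?_⟩
      rw [ZMod.lift_coe]
      change f t = _
      rw [hfk, mul_comm]
      simp [mul_comm]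
    · rintro ⟨t, ht⟩
      obtain ⟨t, rfl⟩ := ZMod.intCast_surjective t
      rw [ZMod.lift_coe] at ht
      have ht' : f t = _ := ht
      rw [hfk, ZMod.intCast_eq_intCast_iff, Int.modEq_iff_dvd] at ht'
      have h1 : (m : ℤ) ∣ y - t * m := (Dvd.intro_left (n : ℤ) (by push_cast; rfl)).trans ht'
      simpa using (Int.dvd_add h1 (Dvd.intro_left t rfl))

/-! ### Upper bound for group extensions -/

/-- Two functions on a group, without a rainbow pair of parallel segments, cannot both have two
private values. -/
theorem not_two_private_values {N κ : Type} [AddCommGroup N] {α β : N → κ}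
    (h : ∀ x y d, α x ≠ α (x + d) → β y ≠ β (y + d) → α x ≠ β y → α x ≠ β (y + d) →
      α (x + d) ≠ β y → α (x + d) ≠ β (y + d) → False)
    {x x' y y' : N} (hx : α x ∉ Set.range β) (hx' : α x' ∉ Set.range β) (hxx : α x ≠ α x')
    (hy : β y ∉ Set.range α) (hy' : β y' ∉ Set.range α) (hyy : β y ≠ β y') : False := by
  -- A segment whose ends have distinct private colors forces all parallel segments of β to be
  -- monochromatic: x' - x is a period of β.
  have key : ∀ {x x'}, α x ∉ Set.range β → α x' ∉ Set.range β → α x ≠ α x' →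
      ∀ z, β (z + (x' - x)) = β z := by
    intro x x' hx hx' hxx z
    by_contra hz
    have e : x + (x' - x) = x' := by abel
    exact h x z (x' - x) (by rwa [e]) (Ne.symm hz) (fun e => hx ⟨_, e.symm⟩)
      (fun e => hx ⟨_, e.symm⟩) (fun e' => hx' ⟨_, by rw [e] at e'; exact e'.symm⟩)
      (fun e' => hx' ⟨_, by rw [e] at e'; exact e'.symm⟩)
  have hper : α (x + (y' - y)) = α x := by
    by_contra hz
    have e : y + (y' - y) = y' := by abel
    exact h x y (y' - y) (Ne.symm hz) (by rwa [e]) (fun e => hy ⟨_, e⟩)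
      (fun e' => hy' ⟨_, by rw [e] at e'; exact e'⟩) (fun e => hy ⟨_, e⟩)
      (fun e' => hy' ⟨_, by rw [e] at e'; exact e'⟩)
  have h1 := key hx hx' hxx y
  -- The translate of x has the same private color, so (x' - x) - (y' - y) is also a period of β.
  -- Both periods lead to the same point, whence β y = β y'.
  have h2 := key (x := x + (y' - y)) (by rwa [hper]) hx' (by rwa [hper]) y'
  have e : y' + (x' - (x + (y' - y))) = y + (x' - x) := by abel
  rw [e, h1] at h2
  exact hyy h2

section Extension

variable {N G Q κ : Type} [AddCommGroup N] [AddCommGroup G] [AddCommGroup Q]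
  {ι : N →+ G} {π : G →+ Q} {c : G → κ}

/-- Some fiber of `π`, with at most as many colors as any other, sees all but one of the colors of
each fiber. -/
theorem exists_dominant_fiber [Finite G] (hex : Function.Exact ι π) (hc : RainbowFree c) :
    ∃ g₀ : G, ∀ g g', π g = π g' → c g ∉ Set.range (fun n => c (g₀ + ι n)) →
      c g' ∉ Set.range (fun n => c (g₀ + ι n)) → c g = c g' := by
  -- The dominant fiber is one with the most colors.
  obtain ⟨g₀, -, hg₀⟩ := Set.exists_max_image (Set.univ : Set G)
    (fun g => (Set.range fun n => c (g + ι n)).ncard) Set.finite_univ ⟨0, trivial⟩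
  refine ⟨g₀, fun g g' hgg hg hg' => ?_⟩
  by_contra hne
  set A := Set.range fun n => c (g₀ + ι n) with hA
  set B := Set.range fun n => c (g + ι n) with hB
  have hfin : ∀ s : G, (Set.range fun n => c (s + ι n)).Finite := fun s =>
    (Set.finite_range c).subset (by rintro _ ⟨n, rfl⟩; exact ⟨_, rfl⟩)
  obtain ⟨d, hd⟩ := (hex (g' - g)).1 (by rw [map_sub, hgg, sub_self])
  have hgd : g' = g + ι d := by rw [hd]; abel
  have hgB : c g ∈ B := ⟨0, by simp⟩
  have hgB' : c g' ∈ B := ⟨d, by rw [hgd]⟩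
  have h2 : 2 ≤ (B \ A).ncard := by
    rw [← Set.ncard_pair hne]
    refine Set.ncard_le_ncard ?_ ((hfin g).subset Set.sdiff_subset)
    rintro _ (rfl | rfl)
    exacts [⟨hgB, hg⟩, ⟨hgB', hg'⟩]
  -- By maximality, two colors of B outside A are matched by two colors of A outside B, so each
  -- fiber has two private values.
  have h3 : (B \ A).ncard ≤ (A \ B).ncard := by
    have h4 := Set.ncard_inter_add_ncard_sdiff_eq_ncard B A (hfin g)
    have h5 := Set.ncard_inter_add_ncard_sdiff_eq_ncard A B (hfin g₀)
    rw [Set.inter_comm] at h5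
    have h6 : B.ncard ≤ A.ncard := hg₀ g trivial
    omega
  obtain ⟨u, ⟨⟨x, rfl⟩, hu⟩, v, ⟨⟨x', rfl⟩, hv⟩, huv⟩ :=
    (Set.one_lt_ncard ((hfin g₀).subset Set.sdiff_subset)).1 (lt_of_lt_of_le one_lt_two (h2.trans h3))
  refine not_two_private_values (α := fun n => c (g₀ + ι n)) (β := fun n => c (g + ι n))
    (fun x y d h1 h2 h3 h4 h5 h6 => ?_) hu hv huv (y := 0) (y' := d) (by rwa [map_zero, add_zero])
    (by rwa [← hgd]) (by simpa [← hgd] using hne)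
  refine hc (g₀ + ι x) (g + ι (y + d)) (g₀ + ι (x + d)) (g + ι y) ?_ h4 h1 h3 h6.symm h2.symm h5
  simp only [map_add]; abel

open Classical in
/-- The color of a fiber of `π` that does not occur in a given set of colors, if there is one. -/
noncomputable def newColor (π : G →+ Q) (c : G → κ) (A : Set κ) (q : Q) : Option κ :=
  if h : ∃ g, π g = q ∧ c g ∉ A then some (c h.choose) else none

theorem newColor_of_notMem {A : Set κ}
    (hA : ∀ g g', π g = π g' → c g ∉ A → c g' ∉ A → c g = c g') {g : G} (hg : c g ∉ A) :
    newColor π c A (π g) = some (c g) := by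
  have h : ∃ g', π g' = π g ∧ c g' ∉ A := ⟨g, rfl, hg⟩
  rw [newColor, dif_pos h, hA _ g h.choose_spec.1 h.choose_spec.2 hg]

theorem exists_of_newColor_eq_some {A : Set κ} {q : Q} {u : κ}
    (h : newColor π c A q = some u) : ∃ g, π g = q ∧ c g = u ∧ u ∉ A := by
  unfold newColor at h
  split_ifs at h with h'
  obtain ⟨h1, h2⟩ := h'.choose_spec
  rw [Option.some_inj] at h
  exact ⟨_, h1, h, h ▸ h2⟩
end Extension

section Extension

variable {N G Q κ : Type} [AddCommGroup N] [AddCommGroup G] [AddCommGroup Q]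
  {ι : N →+ G} {π : G →+ Q} {c : G → κ}

/-- Among four distinct values at most one is `none`, so three are genuine colors outside A. Lift
those three points to G and complete them to a solution. The fourth color either lies in A or is the
new color of its fiber; in both cases it differs from the other three. -/
theorem RainbowFree.newColor (hc : RainbowFree c) {A : Set κ}
    (hA : ∀ g g', π g = π g' → c g ∉ A → c g' ∉ A → c g = c g') :
    RainbowFree (newColor π c A) := by
  have key : ∀ (q₁ q₂ q₃ q₄ : Q) (u v w : κ), q₁ + q₂ = q₃ + q₄ →
      _root_.newColor π c A q₁ = some u → _root_.newColor π c A q₂ = some v →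
      _root_.newColor π c A q₃ = some w → u ≠ v → u ≠ w → v ≠ w →
      _root_.newColor π c A q₄ ≠ some u → _root_.newColor π c A q₄ ≠ some v →
      _root_.newColor π c A q₄ ≠ some w → False := by
    intro q₁ q₂ q₃ q₄ u v w h h₁ h₂ h₃ huv huw hvw hu hv hw
    obtain ⟨g₁, rfl, rfl, hu'⟩ := exists_of_newColor_eq_some h₁
    obtain ⟨g₂, rfl, rfl, hv'⟩ := exists_of_newColor_eq_some h₂
    obtain ⟨g₃, rfl, rfl, hw'⟩ := exists_of_newColor_eq_some h₃
    have h4 : π (g₁ + g₂ - g₃) = q₄ := by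
      rw [map_sub, map_add, h]; abel
    have aux : ∀ s, s ∉ A → _root_.newColor π c A q₄ ≠ some s → s ≠ c (g₁ + g₂ - g₃) := by
      rintro s hs hs' rfl
      exact hs' (h4 ▸ newColor_of_notMem hA hs)
    exact hc g₁ g₂ g₃ (g₁ + g₂ - g₃) (by abel) huv huw (aux _ hu' hu) hvw (aux _ hv' hv)
      (aux _ hw' hw)
  intro q₁ q₂ q₃ q₄ h h12 h13 h14 h23 h24 h34
  rcases e1 : _root_.newColor π c A q₁ with _ | u₁ <;>
  rcases e2 : _root_.newColor π c A q₂ with _ | u₂ <;>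
  rcases e3 : _root_.newColor π c A q₃ with _ | u₃ <;>
  rcases e4 : _root_.newColor π c A q₄ with _ | u₄ <;>
  simp only [e1, e2, e3, e4, ne_eq, not_true_eq_false, Option.some_inj] at h12 h13 h14 h23 h24 h34
  · exact key q₃ q₄ q₂ q₁ _ _ _ (by rw [← h, add_comm]) e3 e4 e2 h34 (Ne.symm h23) (Ne.symm h24)
      (by simp [e1]) (by simp [e1]) (by simp [e1])
  · exact key q₃ q₄ q₁ q₂ _ _ _ h.symm e3 e4 e1 h34 (Ne.symm h13) (Ne.symm h14)
      (by simp [e2]) (by simp [e2]) (by simp [e2])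
  · exact key q₁ q₂ q₄ q₃ _ _ _ (by rw [h, add_comm]) e1 e2 e4 h12 h14 h24
      (by simp [e3]) (by simp [e3]) (by simp [e3])
  · exact key q₁ q₂ q₃ q₄ _ _ _ h e1 e2 e3 h12 h13 h23
      (by simp [e4]) (by simp [e4]) (by simp [e4])
  · exact key q₁ q₂ q₃ q₄ _ _ _ h e1 e2 e3 h12 h13 h23
      (by simpa [e4] using Ne.symm h14) (by simpa [e4] using Ne.symm h24)
      (by simpa [e4] using Ne.symm h34)

/-- The colors of `c` are those in `A` and the new colors of fibers. -/
theorem ncard_range_le_add_newColor [Finite G] [Finite Q] {A : Set κ} (hAf : A.Finite)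
    (hA : ∀ g g', π g = π g' → c g ∉ A → c g' ∉ A → c g = c g') :
    (Set.range c).ncard ≤ A.ncard + {u | some u ∈ Set.range (newColor π c A)}.ncard := by
  have hf : {u | some u ∈ Set.range (newColor π c A)}.Finite :=
    Set.Finite.preimage (Option.some_injective κ).injOn (Set.finite_range _)
  refine (Set.ncard_le_ncard ?_ (hAf.union hf)).trans (Set.ncard_union_le _ _)
  rintro _ ⟨g, rfl⟩
  by_cases h : c g ∈ A
  · exact Or.inl h
  · exact Or.inr ⟨_, newColor_of_notMem hA h⟩

theorem ncard_some_range_lt {X κ : Type} [Finite X] {s : X → Option κ} {q₀ : X} (h : s q₀ = none) :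
    {u | some u ∈ Set.range s}.ncard + 1 ≤ (Set.range s).ncard := by
  have hf : (Set.range s).Finite := Set.finite_range s
  rw [← Set.ncard_image_of_injective _ (Option.some_injective κ)]
  have hsub : some '' {u | some u ∈ Set.range s} ⊆ Set.range s := by
    rintro _ ⟨u, hu, rfl⟩; exact hu
  refine Set.ncard_lt_ncard ⟨hsub, fun h' => ?_⟩ hf
  obtain ⟨u, -, hu⟩ := h' ⟨q₀, rfl⟩
  rw [h] at hu
  cases hu

theorem newColor_eq_none {A : Set κ} {g₀ : G} (hex : Function.Exact ι π)
    (hA : A = Set.range fun n => c (g₀ + ι n)) : newColor π c A (π g₀) = none := by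
  cases e : newColor π c A (π g₀) with
  | none => rfl
  | some u =>
    exfalso
    obtain ⟨g, hg, rfl, hu⟩ := exists_of_newColor_eq_some e
    obtain ⟨n, hn⟩ := (hex (g - g₀)).1 (by rw [map_sub, hg, sub_self])
    exact hu (hA ▸ ⟨n, by simp [hn]⟩)

/-- The number of colors is bounded in terms of the colors of a dominant fiber and the quotient. -/
theorem ncard_range_lt_of_dominant [Finite G] [Finite Q]
    (hex : Function.Exact ι π) (hc : RainbowFree c) {A : Set κ} {g₀ : G}
    (hAg : A = Set.range fun n => c (g₀ + ι n))
    (hA : ∀ g g', π g = π g' → c g ∉ A → c g' ∉ A → c g = c g') {s : ℕ} (hs : ColorBound Q s) :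
    (Set.range c).ncard + 1 ≤ A.ncard + s := by
  have hAf : A.Finite := (Set.finite_range c).subset (by rw [hAg]; rintro _ ⟨n, rfl⟩; exact ⟨_, rfl⟩)
  have h1 := ncard_range_le_add_newColor hAf hA
  have h2 := ncard_some_range_lt (newColor_eq_none hex hAg)
  have h3 := hs _ _ (hc.newColor hA)
  omega

/-- The dominant fiber contributes at most r colors. One of the s + 1 values allowed on the quotient
is `none`, which leaves s new colors. -/
theorem ColorBound.extension [Finite G] [Finite Q]
    (hex : Function.Exact ι π) {r s : ℕ} (hr : ColorBound N r) (hs : ColorBound Q (s + 1)) :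
    ColorBound G (r + s) := by
  intro κ c hc
  obtain ⟨g₀, hA⟩ := exists_dominant_fiber hex hc
  have h1 := ncard_range_lt_of_dominant hex hc rfl hA hs
  have h2 := hr _ _ (hc.comp_hom ι g₀)
  omega

end Extension

/-! ### Powers of three -/

/-- A partial coloring of `ℤ/3^a` in which sums and differences of elements of distinct colors have
one of these colors uses at most `a` colors. -/
theorem ncard_le_of_ultrametric {κ : Type} (a : ℕ) (s : ZMod (3 ^ a) → Option κ) (h0 : s 0 = none)
    (hs : ∀ q q' u v, s q = some u → s q' = some v → u ≠ v →
      (s (q + q') = some u ∨ s (q + q') = some v) ∧ (s (q - q') = some u ∨ s (q - q') = some v)) :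
    {u | some u ∈ Set.range s}.ncard ≤ a := by
  induction a with
  | zero =>
    have : {u | some u ∈ Set.range s} = ∅ := by
      ext u
      simp only [Set.mem_ofPred_eq, Set.mem_empty_iff_false, iff_false]
      rintro ⟨q, hq⟩
      have : q = 0 := Subsingleton.elim (α := ZMod 1) q 0
      rw [this, h0] at hq
      cases hq
    rw [this, Set.ncard_empty]
  | succ a ih =>
    revert s
    rw [pow_succ]
    intro s h0 hs
    obtain ⟨ι, π, hι, hπ, hex⟩ := ZMod.exists_exact (3 ^ a) 3
    have ih' := ih (fun q => s (ι q)) (by simpa using h0) (by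
      intro q q' u v hq hq' huv
      simpa using hs _ _ _ _ hq hq' huv)
    set T := {u | some u ∈ Set.range fun q => s (ι q)}
    have hf : {u | some u ∈ Set.range s}.Finite :=
      Set.Finite.preimage (Option.some_injective κ).injOn (Set.finite_range _)
    -- Only one color can be missing from the index-3 subgroup: for x, y outside it, x + y or x - y
    -- lies inside, and it has the color of x or of y.
    have h1 : ({u | some u ∈ Set.range s} \ T).ncard ≤ 1 := by
      rw [Set.ncard_le_one (hf.subset Set.sdiff_subset)]
      rintro u ⟨⟨x, hx⟩, hu⟩ v ⟨⟨y, hy⟩, hv⟩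
      by_contra huv
      have hT : ∀ z, π z = 0 → s z ≠ some u ∧ s z ≠ some v := by
        intro z hz
        obtain ⟨n, rfl⟩ := (hex z).1 hz
        exact ⟨fun h => hu ⟨n, h⟩, fun h => hv ⟨n, h⟩⟩
      have h3 : ∀ p q : ZMod 3, p ≠ 0 → q ≠ 0 → p + q = 0 ∨ p - q = 0 := by decide
      obtain ⟨ha, hd⟩ := hs x y u v hx hy huv
      rcases h3 (π x) (π y) (fun h => (hT x h).1 hx) (fun h => (hT y h).2 hy) with h | h
      · rw [← map_add] at h
        have := hT _ h
        tauto
      · rw [← map_sub] at h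
        have := hT _ h
        tauto
    have h2 := Set.ncard_le_ncard_sdiff_add_ncard {u | some u ∈ Set.range s} T
      (hf.subset (by rintro u ⟨q, hq⟩; exact ⟨_, hq⟩))
    omega

theorem exists_ne_ne_add (a h : ZMod 3) (hh : h ≠ 0) : ∃ b, b ≠ a ∧ b + h ≠ a := by
  revert a h; decide

theorem colorBound_three_pow (a : ℕ) : ColorBound (ZMod (3 ^ (a + 1))) (a + 3) := by
  induction a with
  | zero =>
    have := colorBound_card (ZMod (3 ^ (0 + 1)))
    simpa using this
  | succ a ih =>
    intro κ c hc
    have e : (3 : ℕ) ^ (a + 1 + 1) = 3 * 3 ^ (a + 1) := by ring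
    revert c
    rw [e]
    intro c hc
    obtain ⟨ι, π, hι, hπ, hex⟩ := ZMod.exists_exact 3 (3 ^ (a + 1))
    obtain ⟨g₀, hA⟩ := exists_dominant_fiber hex hc
    set A := Set.range fun n => c (g₀ + ι n) with hAdef
    have hcard : A.ncard ≤ 3 := by
      simpa using colorBound_card (ZMod 3) _ _ (hc.comp_hom ι g₀)
    -- With at most two colors in the dominant fiber the general bound suffices. Otherwise that
    -- fiber is rainbow, which makes the new colors rigid.
    rcases Nat.lt_or_ge A.ncard 3 with h | h
    · have := ncard_range_lt_of_dominant hex hc hAdef hA ih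
      omega
    have hAf : A.Finite := Set.finite_range _
    have hinj : Function.Injective fun n => c (g₀ + ι n) := by
      rw [← Set.injOn_univ]
      refine Set.injOn_of_ncard_image_eq ?_ Set.finite_univ
      rw [Set.image_univ, ← hAdef, Set.ncard_univ]
      simpa using le_antisymm hcard h
    -- A fiber with a new color is monochromatic: a two-colored segment starting at the new color
    -- would have a parallel segment in the rainbow fiber that avoids its other color.
    have hmono : ∀ x, c x ∉ A → ∀ n, c (x + ι n) = c x := by
      intro x hx n
      by_contra hne
      have hn : n ≠ 0 := by rintro rfl; simp at hne
      obtain ⟨b, hb1, hb2⟩ : ∃ b, c (g₀ + ι b) ≠ c (x + ι n) ∧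
          c (g₀ + ι (b + n)) ≠ c (x + ι n) := by
        by_cases hw : c (x + ι n) ∈ A
        · obtain ⟨b₀, hb₀⟩ := hw
          obtain ⟨b, h1, h2⟩ := exists_ne_ne_add b₀ n hn
          exact ⟨b, fun h => h1 (hinj (h.trans hb₀.symm)), fun h => h2 (hinj (h.trans hb₀.symm))⟩
        · exact ⟨0, fun h => hw ⟨_, h⟩, fun h => hw ⟨_, h⟩⟩
      refine hc x (g₀ + ι (b + n)) (x + ι n) (g₀ + ι b) (by simp only [map_add]; abel)
        (fun h => hx ⟨_, h.symm⟩) (Ne.symm hne) (fun h => hx ⟨_, h.symm⟩) hb2 ?_ (Ne.symm hb1)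
      intro h
      have := hinj h
      simp [hn] at this
    have hexn : ∀ w, ∃ n, c (g₀ + ι n) ≠ w := by
      intro w
      by_contra! hw
      have := hinj ((hw 0).trans (hw 1).symm)
      revert this; decide
    have h1 := ncard_range_le_add_newColor hAf hA
    have h2 := ncard_le_of_ultrametric (a + 1) (fun q => newColor π c A (q + π g₀))
      (by simpa using newColor_eq_none hex hAdef) (by
        intro q q' u v hq hq' huv
        obtain ⟨x, hx, rfl, hxA⟩ := exists_of_newColor_eq_some hq
        obtain ⟨y, hy, rfl, hyA⟩ := exists_of_newColor_eq_some hq'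
        have hfib : ∀ z, π z = π x → c z = c x := by
          intro z hz
          obtain ⟨n, hn⟩ := (hex (z - x)).1 (by rw [map_sub, hz, sub_self])
          have := hmono x hxA n
          rwa [hn, add_sub_cancel] at this
        have fin : ∀ b, c b = c x ∨ c b = c y →
            newColor π c A (π b) = some (c x) ∨ newColor π c A (π b) = some (c y) := by
          rintro b (h | h)
          · left; rw [← h]; exact newColor_of_notMem hA (h ▸ hxA)
          · right; rw [← h]; exact newColor_of_notMem hA (h ▸ hyA)
        have hιπ : ∀ n, π (ι n) = 0 := fun n => (hex _).2 ⟨n, rfl⟩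
        have hA' : ∀ n s, s ∉ A → s ≠ c (g₀ + ι n) := fun n s hs h => hs ⟨n, h.symm⟩
        constructor
        -- The dominant fiber serves as origin. Its point g₀ + ι n is chosen to differ in color from
        -- x + y - g₀; moving x within its monochromatic fiber absorbs ι n.
        · obtain ⟨n, hn⟩ := hexn (c (x + y - g₀))
          have hxn : c (x + ι n) = c x := hmono x hxA n
          have hb : c (x + y - g₀) = c x ∨ c (x + y - g₀) = c y := by
            by_contra! hb
            refine hc (x + ι n) y (x + y - g₀) (g₀ + ι n) (by abel) (by rwa [hxn])
              (by rw [hxn]; exact hb.1.symm) (by rw [hxn]; exact hA' n _ hxA) hb.2.symm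
              (hA' n _ hyA) hn.symm
          have := fin _ hb
          rw [map_sub, map_add, hx, hy] at this
          convert this using 3 <;> abel
        · obtain ⟨n, hn⟩ := hexn (c (x - y + g₀))
          have hxn : c (x - ι n) = c x := by simpa [sub_eq_add_neg] using hmono x hxA (-n)
          have hb : c (x - y + g₀) = c x ∨ c (x - y + g₀) = c y := by
            by_contra! hb
            refine hc (x - ι n) (g₀ + ι n) y (x - y + g₀) (by abel)
              (by rw [hxn]; exact hA' n _ hxA) (by rwa [hxn])
              (by rw [hxn]; exact hb.1.symm) (hA' n _ hyA).symm hn hb.2.symm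
          have := fin _ hb
          rw [map_add, map_sub, hx, hy] at this
          convert this using 3 <;> abel)
    have h3 : (Set.range fun q => newColor π c A (q + π g₀)) = Set.range (newColor π c A) :=
      (Equiv.addRight (π g₀)).surjective.range_comp (newColor π c A)
    rw [h3] at h2
    omega

/-! ### Critical pairs for Cauchy-Davenport in prime order -/

section Prime

open Finset Pointwise

variable {p : ℕ} [Fact p.Prime]

/-- A critical pair for the Cauchy-Davenport inequality yields one whose first member has translates
that meet in at most one point. -/
theorem exists_sidon_of_critical (hp3 : 3 ≤ p) {S F : Finset (ZMod p)} (hS : S.Nonempty)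
    (hF : 2 ≤ #F) (hFS : #(F + S) + 1 ≤ #F + #S) (hp : 2 * #F + #S ≤ p + 3) :
    ∃ M : Finset (ZMod p), 2 ≤ #M ∧ #M ≤ #F ∧ #(M + S) + 1 ≤ #M + #S ∧
      ∀ x y, x ≠ y → #((M + {x}) ∩ (M + {y})) ≤ 1 := by
  -- M is a critical set of least size. If two translates met in at least two points, submodularity
  -- of X ↦ #(X + S) would make their intersection critical. By minimality the translates would then
  -- coincide, against Cauchy-Davenport for M + {x, y}. The bound on 2 * #F + #S keeps the union
  -- from wrapping around.
  obtain ⟨M, hM, hmin⟩ := exists_min_image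
    (univ.filter fun M : Finset (ZMod p) => 2 ≤ #M ∧ #(M + S) + 1 ≤ #M + #S) card
    ⟨F, by simpa only [mem_filter, mem_univ, true_and] using ⟨hF, hFS⟩⟩
  simp only [mem_filter, mem_univ, true_and] at hM hmin
  have hMF := hmin F ⟨hF, hFS⟩
  have hSpos := hS.card_pos
  refine ⟨M, hM.1, hMF, hM.2, fun x y hxy => ?_⟩
  by_contra! hI
  have hMne : M.Nonempty := card_pos.1 (by omega)
  have hun : M + {x, y} = (M + {x}) ∪ (M + {y}) := by
    rw [← add_union]; rfl
  have hcx : ∀ z, #(M + {z}) = #M := fun z => card_add_singleton M z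
  have hcSx : ∀ z, #(M + {z} + S) = #(M + S) := fun z => by
    rw [add_right_comm, card_add_singleton]
  have h1 := card_union_add_card_inter (M + {x}) (M + {y})
  rw [hcx, hcx] at h1
  have hJ : ((M + {x}) ∪ (M + {y})).Nonempty := hun ▸ hMne.add ⟨x, by simp⟩
  have h2 := ZMod.cauchy_davenport (Fact.out : p.Prime) hJ hS
  have h3 := card_union_add_card_inter (M + {x} + S) (M + {y} + S)
  rw [hcSx, hcSx, ← union_add] at h3
  have h4 : #((M + {x}) ∩ (M + {y}) + S) ≤ #((M + {x} + S) ∩ (M + {y} + S)) :=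
    card_le_card inter_add_subset
  have h5 := ZMod.cauchy_davenport (Fact.out : p.Prime) hMne (t := {x, y}) ⟨x, by simp⟩
  rw [hun, card_pair hxy] at h5
  have h6 := hmin ((M + {x}) ∩ (M + {y}))
  omega

/-- Translates of B by elements of A are almost disjoint, so two or three of them already overfill A
+ B once B has three elements. -/
theorem card_le_two_of_sidon {A B : Finset (ZMod p)} (hA : 2 ≤ #A) (hAB : #A ≤ #B)
    (h : #(A + B) + 1 ≤ #A + #B) (hB : ∀ x y, x ≠ y → #((B + {x}) ∩ (B + {y})) ≤ 1) :
    #B ≤ 2 := by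
  have hc : ∀ z, #(B + {z}) = #B := fun z => card_add_singleton B z
  have hsub : ∀ a ∈ A, B + {a} ⊆ A + B := fun a ha => by
    rw [add_comm A B]; exact add_subset_add_left (by simpa using ha)
  by_contra! hB3
  rcases Nat.lt_or_ge 2 (#A) with h3 | h3
  · obtain ⟨x, y, z, hx, hy, hz, hxy, hxz, hyz⟩ := two_lt_card_iff.1 h3
    have h1 := card_union_add_card_inter (B + {x}) (B + {y})
    have h2 := card_union_add_card_inter (B + {x} ∪ (B + {y})) (B + {z})
    have h4 : #((B + {x} ∪ (B + {y})) ∩ (B + {z})) ≤ 1 + 1 := by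
      rw [union_inter_distrib_right]
      exact (card_union_le _ _).trans (add_le_add (hB _ _ hxz) (hB _ _ hyz))
    have h5 := card_le_card (union_subset (union_subset (hsub x hx) (hsub y hy)) (hsub z hz))
    have h6 := hB x y hxy
    rw [hc, hc] at h1
    rw [hc] at h2
    omega
  · obtain ⟨x, hx, y, hy, hxy⟩ := one_lt_card.1 hA
    have h1 := card_union_add_card_inter (B + {x}) (B + {y})
    have h5 := card_le_card (union_subset (hsub x hx) (hsub y hy))
    have h6 := hB x y hxy
    rw [hc, hc] at h1
    omega

theorem forall_of_forall_add {P : ZMod p → Prop} {d : ZMod p} (hd : d ≠ 0)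
    (h : ∀ y, P y → P (y + d)) {x : ZMod p} (hx : P x) (y : ZMod p) : P y := by
  have hk : ∀ k : ℕ, P (x + k * d) := by
    intro k
    induction k with
    | zero => simpa using hx
    | succ k ih =>
      have := h _ ih
      rwa [show x + (k : ZMod p) * d + d = x + ((k + 1 : ℕ) : ZMod p) * d by push_cast; ring] at this
  have := hk ((y - x) / d).val
  rwa [ZMod.natCast_zmod_val, div_mul_cancel₀ _ hd, add_sub_cancel] at this

/-- U ∪ {0} and V ∪ {0} form a critical pair, since their sum stays in U ∪ V ∪ {0}. Reducing each in
turn to a minimal critical set yields a two-element set {m, m'} critical with E = U ∪ {0}. Hence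
translation by d = m' - m moves at most one point into E and at most one out of it. -/
theorem not_ultrametric_partition_of_card_le (hp3 : 3 ≤ p) {U V W : Finset (ZMod p)}
    (hU : U.Nonempty) (hV : V.Nonempty) (hW : W.Nonempty) (hU0 : 0 ∉ U) (hV0 : 0 ∉ V) (hW0 : 0 ∉ W)
    (hUV : Disjoint U V) (hUW : Disjoint U W) (hVW : Disjoint V W)
    (hcard : #U + #V + #W + 1 = p) (hneg : ∀ u ∈ U, -u ∈ U)
    (hsumV : ∀ u ∈ U, ∀ v ∈ V, u + v ∈ U ∪ V) (hsumW : ∀ u ∈ U, ∀ w ∈ W, u + w ∈ U ∪ W)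
    (hle : #U ≤ #W) (hle' : #V ≤ #W) : False := by
  have hcU : #(insert 0 U) = #U + 1 := card_insert_of_notMem hU0
  have hcV : #(insert 0 V) = #V + 1 := card_insert_of_notMem hV0
  have hUpos := hU.card_pos
  have hVpos := hV.card_pos
  have hsub : insert 0 V + insert 0 U ⊆ insert 0 (U ∪ V) := by
    intro x hx
    obtain ⟨v, hv, u, hu, rfl⟩ := mem_add.1 hx
    rcases mem_insert.1 hv with rfl | hv <;> rcases mem_insert.1 hu with rfl | hu
    · simp
    · simp [hu]
    · simp [hv]
    · rw [add_comm v u]; exact mem_insert_of_mem (hsumV u hu v hv)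
  have h1 : #(insert 0 V + insert 0 U) ≤ #U + #V + 1 := by
    refine (card_le_card hsub).trans ((card_insert_le _ _).trans ?_)
    rw [card_union_of_disjoint hUV]
  obtain ⟨M, hM2, hMF, hMS, hMsid⟩ := exists_sidon_of_critical hp3 (S := insert 0 U)
    (F := insert 0 V) ⟨0, by simp⟩ (by omega) (by omega) (by omega)
  obtain ⟨K, hK2, hKF, hKS, hKsid⟩ := exists_sidon_of_critical hp3 (S := M)
    (F := insert 0 U) (card_pos.1 (by omega)) (by omega) (by rw [add_comm (insert 0 U) M]; omega)
    (by omega)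
  have hM : #M = 2 := by
    rcases le_total (#K) (#M) with h | h
    · have := card_le_two_of_sidon hK2 h hKS hMsid
      omega
    · have := card_le_two_of_sidon hM2 h (by rw [add_comm M K]; omega) hKsid
      omega
  obtain ⟨m, m', hmm, rfl⟩ := card_eq_two.1 hM
  set E := insert 0 U with hE
  have hd : m' - m ≠ 0 := sub_ne_zero.2 hmm.symm
  set d := m' - m with hddef
  have hEM : ({m, m'} : Finset (ZMod p)) + E = (E ∪ (E + {d})) + {m} := by
    rw [union_add, add_assoc, singleton_add_singleton, hddef, sub_add_cancel, ← add_union,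
      add_comm E]
    rfl
  have hun : #(E ∪ (E + {d})) ≤ #E + 1 := by
    rw [hEM, card_add_singleton] at hMS
    omega
  have hcEd : #(E + {d}) = #E := card_add_singleton E d
  have hexit : #((E + {d}) \ E) ≤ 1 := by
    have := card_sdiff_add_card (E + {d}) E
    rw [union_comm] at this; omega
  have hentry : #(E \ (E + {d})) ≤ 1 := by
    have := card_sdiff_add_card E (E + {d})
    omega
  have hleave : ∀ X : Finset (ZMod p), X.Nonempty → Disjoint U X → ∃ x ∈ X, x + d ∉ X := by
    intro X ⟨x, hx⟩ hX
    by_contra! h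
    obtain ⟨u, hu⟩ := hU
    exact disjoint_left.1 hX hu (forall_of_forall_add hd h hx u)
  -- If d ∈ U, then V and W, not being invariant under d, each send a point into U: two entries into
  -- E. If d ∉ U, the step from 0 to d is the only exit from E, so U is invariant under d and
  -- contains 0.
  by_cases hdU : d ∈ U
  · have hnotE : ∀ X : Finset (ZMod p), 0 ∉ X → Disjoint U X → ∀ x ∈ X, x + d ∉ E + {d} := by
      intro X h0 hX x hx h
      obtain ⟨e, he, h⟩ := mem_add.1 h
      simp only [mem_singleton, exists_eq_left, add_left_inj] at h
      subst h
      rcases mem_insert.1 he with rfl | he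
      exacts [h0 hx, disjoint_left.1 hX he hx]
    obtain ⟨v, hv, hvd⟩ := hleave V hV hUV
    obtain ⟨w, hw, hwd⟩ := hleave W hW hUW
    have h1 : v + d ∈ E \ (E + {d}) := by
      rw [mem_sdiff]
      refine ⟨mem_insert_of_mem ?_, hnotE V hV0 hUV v hv⟩
      have := hsumV d hdU v hv
      rw [add_comm, mem_union] at this
      tauto
    have h2 : w + d ∈ E \ (E + {d}) := by
      rw [mem_sdiff]
      refine ⟨mem_insert_of_mem ?_, hnotE W hW0 hUW w hw⟩
      have := hsumW d hdU w hw
      rw [add_comm, mem_union] at this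
      tauto
    have := card_le_one.1 hentry _ h1 _ h2
    rw [add_left_inj] at this
    subst this
    exact disjoint_left.1 hVW hv hw
  · have h1 : d ∈ (E + {d}) \ E := by
      rw [mem_sdiff]
      exact ⟨mem_add.2 ⟨0, by simp [hE], d, by simp, zero_add d⟩, by simp [hE, hd, hdU]⟩
    have h2 : ∀ u ∈ U, u + d ∈ U := by
      intro u hu
      have hne : u + d ≠ 0 := by
        intro h
        apply hdU
        rw [← neg_eq_of_add_eq_zero_right h]
        exact hneg u hu
      by_contra h
      have h3 : u + d ∈ (E + {d}) \ E := by
        rw [mem_sdiff]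
        exact ⟨mem_add.2 ⟨u, mem_insert_of_mem hu, d, by simp, rfl⟩, by simp [hE, hne, h]⟩
      have := card_le_one.1 hexit _ h1 _ h3
      have hu0 : u = 0 := by simpa using this
      exact hU0 (hu0 ▸ hu)
    obtain ⟨u, hu⟩ := hU
    exact hU0 (forall_of_forall_add hd h2 hu 0)

end Prime

section Prime

open Finset

variable {p : ℕ} [Fact p.Prime]

/-- The hypotheses are symmetric enough to let the largest class play the role of W. -/
theorem not_ultrametric_partition (hp3 : 3 ≤ p) {U V W : Finset (ZMod p)}
    (hU : U.Nonempty) (hV : V.Nonempty) (hW : W.Nonempty) (hU0 : 0 ∉ U) (hV0 : 0 ∉ V) (hW0 : 0 ∉ W)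
    (hUV : Disjoint U V) (hUW : Disjoint U W) (hVW : Disjoint V W)
    (hcover : ∀ d ≠ 0, d ∈ U ∨ d ∈ V ∨ d ∈ W)
    (hnegU : ∀ u ∈ U, -u ∈ U) (hnegV : ∀ v ∈ V, -v ∈ V)
    (hsumUV : ∀ u ∈ U, ∀ v ∈ V, u + v ∈ U ∪ V) (hsumUW : ∀ u ∈ U, ∀ w ∈ W, u + w ∈ U ∪ W)
    (hsumVW : ∀ v ∈ V, ∀ w ∈ W, v + w ∈ V ∪ W) : False := by
  have hcard : #U + #V + #W + 1 = p := by
    have h : insert 0 (U ∪ V ∪ W) = univ := by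
      ext d
      by_cases hd : d = 0
      · simp [hd]
      · simpa [hd] using hcover d hd
    have h' := congrArg card h
    rw [card_insert_of_notMem (by simp [hU0, hV0, hW0]),
      card_union_of_disjoint (disjoint_union_left.2 ⟨hUW, hVW⟩), card_union_of_disjoint hUV,
      card_univ, ZMod.card] at h'
    exact h'
  have swap : ∀ {X Y : Finset (ZMod p)}, (∀ x ∈ X, ∀ y ∈ Y, x + y ∈ X ∪ Y) →
      ∀ y ∈ Y, ∀ x ∈ X, y + x ∈ Y ∪ X := by
    intro X Y h y hy x hx
    rw [add_comm, union_comm]; exact h x hx y hy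
  by_cases h1 : #U ≤ #W ∧ #V ≤ #W
  · exact not_ultrametric_partition_of_card_le hp3 hU hV hW hU0 hV0 hW0 hUV hUW hVW hcard hnegU
      hsumUV hsumUW h1.1 h1.2
  by_cases h2 : #U ≤ #V ∧ #W ≤ #V
  · exact not_ultrametric_partition_of_card_le hp3 hU hW hV hU0 hW0 hV0 hUW hUV hVW.symm (by omega)
      hnegU hsumUW hsumUV h2.1 h2.2
  · exact not_ultrametric_partition_of_card_le hp3 hV hW hU hV0 hW0 hU0 hVW hUV.symm hUW.symm
      (by omega) hnegV hsumVW (swap hsumUV) (by omega) (by omega)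

/-! ### Rainbow-free colorings in prime order -/

/-- The color pairs of non-monochromatic segments of difference d pairwise intersect, so they form a
star or a triangle. A triangle is impossible: no color class is invariant under d, so a fourth color
would lie in a pair meeting all three sides. -/
theorem exists_dominant_color {κ : Type} {c : ZMod p → κ} (hc : RainbowFree c)
    (h4 : ∀ a b e, ∃ x, c x ≠ a ∧ c x ≠ b ∧ c x ≠ e) {d : ZMod p} (hd : d ≠ 0) :
    ∃ R, ∀ x, c x ≠ c (x + d) → c x = R ∨ c (x + d) = R := by
  classical
  have hint : ∀ x y, c x ≠ c (x + d) → c y ≠ c (y + d) →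
      c x = c y ∨ c x = c (y + d) ∨ c (x + d) = c y ∨ c (x + d) = c (y + d) := by
    intro x y hx hy
    by_contra! h
    exact hc x (y + d) (x + d) y (by ring) h.2.1 hx h.1 h.2.2.2.symm hy.symm h.2.2.1
  have hleave : ∀ x, ∃ y, c y = c x ∧ c y ≠ c (y + d) := by
    intro x
    by_contra! h
    obtain ⟨z, hz, -, -⟩ := h4 (c x) (c x) (c x)
    exact hz (forall_of_forall_add (P := fun y => c y = c x) hd
      (fun y hy => (h y hy).symm.trans hy) rfl z)
  by_contra! h
  obtain ⟨x, hx, hx1, -⟩ := h (c 0)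
  obtain ⟨y, hy, hy1, hy2⟩ := h (c x)
  obtain ⟨z, hz, hz1, hz2⟩ := h (c (x + d))
  -- The pair at y avoids c x, so it contains c (x + d); its other entry is the third vertex of the
  -- triangle.
  obtain ⟨t, ht1, ht2, ht3⟩ := h4 (c x) (c (x + d)) (if c y = c (x + d) then c (y + d) else c y)
  obtain ⟨w, hw, hwd⟩ := hleave t
  have i1 := hint x y hx hy
  have i2 := hint x z hx hz
  have i3 := hint y z hy hz
  have i4 := hint w x hwd hx
  have i5 := hint w y hwd hy
  have i6 := hint w z hwd hz
  split_ifs at ht3 <;> grind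

/-- With four colors, the dominant color R d behaves like an ultrametric valuation of the difference
d, even under negation and taking at least three values. Its level sets, with all but two merged,
give the excluded partition. -/
theorem colorBound_prime (hp : 5 ≤ p) : ColorBound (ZMod p) 3 := by
  intro κ c hc
  by_contra! hcard
  have h4 : ∀ a b e, ∃ x, c x ≠ a ∧ c x ≠ b ∧ c x ≠ e := by
    intro a b e
    by_contra! h
    have hsub : Set.range c ⊆ (({a, b, e} : Set κ)) := by
      rintro _ ⟨x, rfl⟩
      have := h x
      simp only [Set.mem_insert_iff, Set.mem_singleton_iff]
      tauto
    have h1 := Set.ncard_le_ncard hsub (Set.toFinite _)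
    have h2 := Set.ncard_insert_le a {b, e}
    have h3 := Set.ncard_insert_le b {e}
    rw [Set.ncard_singleton] at h3
    omega
  have : Nonempty κ := ⟨c 0⟩
  have hstar : ∀ d : ZMod p, ∃ R, d ≠ 0 → ∀ x, c x ≠ c (x + d) → c x = R ∨ c (x + d) = R := by
    intro d
    by_cases hd : d = 0
    · exact ⟨c 0, fun h => absurd hd h⟩
    · obtain ⟨R, hR⟩ := exists_dominant_color hc h4 hd
      exact ⟨R, fun _ => hR⟩
  choose R hR using hstar
  have hleave : ∀ d ≠ 0, ∀ x, c x ≠ R d → ∃ y, c y = c x ∧ c (y + d) = R d := by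
    intro d hd x hx
    by_contra! h
    obtain ⟨z, hz, -, -⟩ := h4 (c x) (c x) (c x)
    refine hz (forall_of_forall_add (P := fun y => c y = c x) hd (fun y hy => ?_) rfl z)
    by_contra hne
    rcases hR d hd y (by rw [hy]; exact Ne.symm hne) with h' | h'
    · exact hx (hy ▸ h')
    · exact h y hy h'
  have hmix : ∀ d e, d ≠ 0 → e ≠ 0 → d + e ≠ 0 → R d ≠ R e →
      R (d + e) = R d ∨ R (d + e) = R e := by
    intro d e hd he hde hne
    -- Steps d and then e from a suitable point of color c x end in color R d or R e, so R (d + e)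
    -- is one of these or c x. Two choices of c x rule out the last option.
    have aux : ∀ x, c x ≠ R d → c x ≠ R e →
        R (d + e) = R d ∨ R (d + e) = R e ∨ R (d + e) = c x := by
      intro x h1 h2
      obtain ⟨y, hy, hyd⟩ := hleave d hd x h1
      have h3 : c (y + d + e) = R d ∨ c (y + d + e) = R e := by
        by_cases h : c (y + d) = c (y + d + e)
        · exact Or.inl (h.symm.trans hyd)
        · rcases hR e he _ h with h' | h'
          · exact absurd (hyd.symm.trans h') hne
          · exact Or.inr h'
      rw [add_assoc] at h3
      have h4 : c y ≠ c (y + (d + e)) := by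
        rw [hy]; intro h; rw [← h] at h3; tauto
      have h5 := hR (d + e) hde y h4
      grind
    obtain ⟨x, hx1, hx2, -⟩ := h4 (R d) (R e) (R e)
    obtain ⟨y, hy1, hy2, hy3⟩ := h4 (R d) (R e) (c x)
    have h1 := aux x hx1 hx2
    have h2 := aux y hy1 hy2
    grind
  have hneg : ∀ d ≠ 0, R (-d) = R d := by
    intro d hd
    by_contra hne
    have aux : ∀ x, c x ≠ R d → R (-d) = c x := by
      intro x hx
      obtain ⟨y, hy, hyd⟩ := hleave d hd x hx
      have h := hR (-d) (neg_ne_zero.2 hd) (y + d)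
      rw [add_neg_cancel_right, hyd, hy] at h
      rcases h hx.symm with h | h
      · exact absurd h.symm hne
      · exact h.symm
    obtain ⟨x, hx1, -, -⟩ := h4 (R d) (R d) (R d)
    obtain ⟨y, hy1, hy2, -⟩ := h4 (R d) (c x) (c x)
    exact hy2 ((aux y hy1).symm.trans (aux x hx1))
  have hval : ∀ a b, ∃ d, d ≠ 0 ∧ R d ≠ a ∧ R d ≠ b := by
    intro a b
    obtain ⟨x, hx1, hx2, -⟩ := h4 a b b
    obtain ⟨y, hy1, hy2, hy3⟩ := h4 a b (c x)
    have hne : x - y ≠ 0 := by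
      intro h; rw [sub_eq_zero] at h; rw [h] at hy3; exact hy3 rfl
    have := hR (x - y) hne y
    rw [add_sub_cancel] at this
    exact ⟨x - y, hne, by grind⟩
  obtain ⟨d₁, hd₁, -, -⟩ := hval (c 0) (c 0)
  obtain ⟨d₂, hd₂, h21, -⟩ := hval (R d₁) (R d₁)
  obtain ⟨d₃, hd₃, h31, h32⟩ := hval (R d₁) (R d₂)
  have hnz : ∀ d e, d ≠ 0 → R d ≠ R e → d + e ≠ 0 := by
    intro d e hd hne h
    rw [← neg_eq_of_add_eq_zero_right h, hneg d hd] at hne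
    exact hne rfl
  classical
  refine not_ultrametric_partition (by omega) (U := univ.filter fun d => d ≠ 0 ∧ R d = R d₁)
    (V := univ.filter fun d => d ≠ 0 ∧ R d = R d₂)
    (W := univ.filter fun d => d ≠ 0 ∧ R d ≠ R d₁ ∧ R d ≠ R d₂)
    ⟨d₁, by simp [hd₁]⟩ ⟨d₂, by simp [hd₂]⟩ ⟨d₃, by simp [hd₃, h31, h32]⟩
    (by simp) (by simp) (by simp) ?_ ?_ ?_ ?_ ?_ ?_ ?_ ?_ ?_
  · rw [disjoint_left]; intro d; simp only [mem_filter, mem_univ, true_and]; grind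
  · rw [disjoint_left]; intro d; simp only [mem_filter, mem_univ, true_and]; grind
  · rw [disjoint_left]; intro d; simp only [mem_filter, mem_univ, true_and]; grind
  · intro d hd; simp only [mem_filter, mem_univ, true_and]; tauto
  · intro d; simp only [mem_filter, mem_univ, true_and, neg_ne_zero]
    rintro ⟨hd, h⟩; exact ⟨hd, (hneg d hd).trans h⟩
  · intro d; simp only [mem_filter, mem_univ, true_and, neg_ne_zero]
    rintro ⟨hd, h⟩; exact ⟨hd, (hneg d hd).trans h⟩
  all_goals
    intro d hd e he
    simp only [mem_filter, mem_univ, true_and, mem_union] at hd he ⊢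
    have hne : R d ≠ R e := by grind
    have h0 := hnz d e hd.1 hne
    have := hmix d e hd.1 he.1 h0 hne
    grind

end Prime

/-! ### Lower bound by extending colorings -/

/-- The complement of the subgroup has at most two colors, so a rainbow solution has at least two
points in the subgroup. Three such points force the fourth. With exactly two, the images of the
other two in Q are equal or opposite, hence they have the same color. -/
theorem HasColoring.extension {N G Q : Type} [AddCommGroup N] [AddCommGroup G] [AddCommGroup Q]
    [Finite N] [Finite G] {ι : N →+ G} {π : G →+ Q} (hι : Function.Injective ι)
    (hπ : Function.Surjective π) (hex : Function.Exact ι π) {r : ℕ} (h : HasColoring N r)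
    {δ : Q → Bool} (hδ : ∀ q, δ (-q) = δ q) : HasColoring G (r + (δ '' {0}ᶜ).ncard) := by
  classical
  obtain ⟨κ, c, hc, hr⟩ := h
  let c' : G → κ ⊕ Bool := fun g =>
    if h : ∃ n, ι n = g then Sum.inl (c h.choose) else Sum.inr (δ (π g))
  have hin : ∀ n, c' (ι n) = Sum.inl (c n) := by
    intro n
    have h : ∃ n', ι n' = ι n := ⟨n, rfl⟩
    simp only [c', dif_pos h, hι h.choose_spec]
  have hout : ∀ g, π g ≠ 0 → c' g = Sum.inr (δ (π g)) := by
    intro g hg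
    have h : ¬ ∃ n, ι n = g := fun h => hg ((hex g).2 h)
    simp only [c', dif_neg h]
  have hι0 : ∀ n, π (ι n) = 0 := fun n => (hex _).2 ⟨n, rfl⟩
  have hcase : ∀ g, (∃ n, ι n = g) ∨ π g ≠ 0 := fun g => by
    by_cases h : π g = 0
    exacts [Or.inl ((hex g).1 h), Or.inr h]
  have hδ' : ∀ q q', q + q' = 0 → δ q = δ q' := by
    intro q q' h
    rw [← neg_eq_of_add_eq_zero_right h, hδ]
  have hthree : ∀ g₁ g₂ g₃, π g₁ ≠ 0 → π g₂ ≠ 0 → π g₃ ≠ 0 →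
      c' g₁ ≠ c' g₂ → c' g₁ ≠ c' g₃ → c' g₂ ≠ c' g₃ → False := by
    intro g₁ g₂ g₃ h₁ h₂ h₃
    rw [hout _ h₁, hout _ h₂, hout _ h₃]
    generalize δ (π g₁) = u, δ (π g₂) = v, δ (π g₃) = w
    revert u v w
    simp
  refine ⟨κ ⊕ Bool, c', ?_, ?_⟩
  · intro a b x y h
    have hs : π a + π b = π x + π y := by rw [← map_add, h, map_add]
    rcases hcase a with ⟨a, rfl⟩ | ha <;> rcases hcase b with ⟨b, rfl⟩ | hb <;>
    rcases hcase x with ⟨x, rfl⟩ | hx <;> rcases hcase y with ⟨y, rfl⟩ | hy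
    · rw [← map_add, ← map_add] at h
      simpa only [hin, ne_eq, Sum.inl.injEq] using hc a b x y (hι h)
    all_goals
      try simp only [hι0, zero_add, add_zero] at hs
      try have e1 := hout _ ha
      try have e2 := hout _ hb
      try have e3 := hout _ hx
      try have e4 := hout _ hy
      try have e5 := hδ' _ _ hs
      try have e6 := hδ' _ _ hs.symm
      intro h1 h2 h3 h4 h5 h6
      first
        | exact hthree _ _ _ hb hx hy h4 h5 h6
        | exact hthree _ _ _ ha hx hy h2 h3 h6
        | exact hthree _ _ _ ha hb hy h1 h3 h5
        | exact hthree _ _ _ ha hb hx h1 h2 h4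
        | clear hthree hc hcase hδ hδ' hout hex hπ hι
          clear_value c'
          grind
  · have hsub : Sum.inl '' Set.range c ∪ Sum.inr '' (δ '' {0}ᶜ) ⊆ Set.range c' := by
      rintro _ (⟨_, ⟨n, rfl⟩, rfl⟩ | ⟨_, ⟨q, hq, rfl⟩, rfl⟩)
      · exact ⟨ι n, hin n⟩
      · obtain ⟨g, rfl⟩ := hπ q
        exact ⟨g, hout g hq⟩
    have h1 := Set.ncard_le_ncard hsub (Set.finite_range _)
    rw [Set.ncard_union_eq (by
        rw [Set.disjoint_left]
        rintro _ ⟨u, -, rfl⟩ ⟨v, -, h⟩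
        cases h) ((Set.finite_range c).image _) (Set.toFinite _),
      Set.ncard_image_of_injective _ Sum.inl_injective,
      Set.ncard_image_of_injective _ Sum.inr_injective] at h1
    omega

/-- The number of colors that a prime factor contributes. -/
def primeWeight (q : ℕ) : ℕ := if q ≤ 3 then 1 else 2

theorem five_le_of_prime {q : ℕ} (hq : q.Prime) (h : ¬ q ≤ 3) : 5 ≤ q := by
  rcases Nat.lt_or_ge q 5 with h' | h'
  · obtain rfl : q = 4 := by omega
    exact absurd hq (by norm_num)
  · exact h'

theorem HasColoring.mul_prime {n q r : ℕ} [NeZero n] (hq : q.Prime) (h : HasColoring (ZMod n) r) :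
    HasColoring (ZMod (n * q)) (r + primeWeight q) := by
  have : Fact q.Prime := ⟨hq⟩
  obtain ⟨ι, π, hι, hπ, hex⟩ := ZMod.exists_exact n q
  unfold primeWeight
  split_ifs with h3
  · have := h.extension hι hπ hex (δ := fun _ => true) fun _ => rfl
    rwa [Set.Nonempty.image_const ⟨1, by simp⟩, Set.ncard_singleton] at this
  · have h5 := five_le_of_prime hq h3
    -- For q ≥ 5 the classes {1, -1} and its complement are symmetric, and 2 is a nonzero element of
    -- the latter.
    have := h.extension hι hπ hex (δ := fun x => decide (x = 1 ∨ x = -1)) fun x => by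
      simp only [neg_eq_iff_eq_neg, neg_neg, or_comm]
    have hne : ∀ k : ℕ, 0 < k → k < 5 → (k : ZMod q) ≠ 0 := by
      intro k hk hk5 h
      rw [ZMod.natCast_eq_zero_iff] at h
      have := Nat.le_of_dvd hk h
      omega
    have himg : (fun x : ZMod q => decide (x = 1 ∨ x = -1)) '' {0}ᶜ = Set.univ := by
      rw [Set.eq_univ_iff_forall]
      rintro (_ | _)
      · refine ⟨2, by simpa using hne 2 (by norm_num) (by norm_num), ?_⟩
        rw [decide_eq_false_iff_not]
        rintro (h | h)
        · exact hne 1 (by norm_num) (by norm_num) (by push_cast; linear_combination h)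
        · exact hne 3 (by norm_num) (by norm_num) (by push_cast; linear_combination h)
      · exact ⟨1, by simp, by simp⟩
    rw [himg, Set.ncard_univ] at this
    simpa using this

/-- The prime 3 is excluded because ℤ/3 admits three colors, so the extension bound would add 2
instead of 1. -/
theorem ColorBound.mul_prime {n q r : ℕ} [NeZero n] (hq : q.Prime) (hq3 : q ≠ 3)
    (h : ColorBound (ZMod n) r) : ColorBound (ZMod (n * q)) (r + primeWeight q) := by
  have : Fact q.Prime := ⟨hq⟩
  obtain ⟨ι, π, -, -, hex⟩ := ZMod.exists_exact n q
  refine h.extension hex ?_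
  unfold primeWeight
  split_ifs with h3
  · obtain rfl : q = 2 := by have := hq.two_le; omega
    simpa using colorBound_card (ZMod 2)
  · exact colorBound_prime (five_le_of_prime hq h3)

theorem hasColoring_three_pow (a : ℕ) : HasColoring (ZMod (3 ^ (a + 1))) (a + 3) := by
  induction a with
  | zero =>
    refine ⟨ZMod 3, id, ?_, ?_⟩
    · have h : ∀ a b x y : ZMod 3,
          ¬ (a ≠ b ∧ a ≠ x ∧ a ≠ y ∧ b ≠ x ∧ b ≠ y ∧ x ≠ y) := by
        decide
      exact fun a b x y _ h1 h2 h3 h4 h5 h6 => h a b x y ⟨h1, h2, h3, h4, h5, h6⟩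
    · simp [Set.ncard_univ]
  | succ a ih =>
    have := ih.mul_prime Nat.prime_three
    rwa [← pow_succ] at this

/-! ### Assembling the prime factors and the rainbow number -/

theorem colorBound_hasColoring_mul_prod {n r : ℕ} [NeZero n] (hb : ColorBound (ZMod n) r)
    (hc : HasColoring (ZMod n) r) (s : Multiset ℕ) (hs : ∀ q ∈ s, q.Prime ∧ q ≠ 3) :
    ColorBound (ZMod (n * s.prod)) (r + (s.map primeWeight).sum) ∧
      HasColoring (ZMod (n * s.prod)) (r + (s.map primeWeight).sum) := by
  induction s using Multiset.induction_on with
  | empty => rw [Multiset.prod_zero, mul_one]; exact ⟨hb, hc⟩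
  | cons q s ih =>
    obtain ⟨h1, h2⟩ := ih fun q' hq' => hs q' (Multiset.mem_cons_of_mem hq')
    obtain ⟨hq, hq3⟩ := hs q (Multiset.mem_cons_self q s)
    have : NeZero (n * s.prod) := ⟨mul_ne_zero (NeZero.ne n) (Multiset.prod_ne_zero fun h0 =>
      (hs 0 (Multiset.mem_cons_of_mem h0)).1.ne_zero rfl)⟩
    rw [Multiset.prod_cons, Multiset.map_cons, Multiset.sum_cons, mul_comm q, ← mul_assoc,
      add_comm (primeWeight q), ← add_assoc]
    exact ⟨h1.mul_prime hq hq3, h2.mul_prime hq⟩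

/-- The largest number of colors in a rainbow-free coloring of `ℤ/n`, where `n` is the product of
the multiset of primes `s`. -/
theorem colorBound_hasColoring_prod (s : Multiset ℕ) (hs : ∀ q ∈ s, q.Prime) :
    ColorBound (ZMod s.prod) (1 + (s.map primeWeight).sum + if 3 ∈ s then 1 else 0) ∧
      HasColoring (ZMod s.prod) (1 + (s.map primeWeight).sum + if 3 ∈ s then 1 else 0) := by
  have hdec := Multiset.filter_add_not (fun q => 3 = q) s
  rw [Multiset.filter_eq] at hdec
  set t := s.filter fun q => ¬ 3 = q with ht
  have hts : ∀ q ∈ t, q.Prime ∧ q ≠ 3 := by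
    intro q hq
    rw [ht, Multiset.mem_filter] at hq
    exact ⟨hs q hq.1, Ne.symm hq.2⟩
  have hprod : s.prod = 3 ^ s.count 3 * t.prod := by
    conv_lhs => rw [← hdec]
    rw [Multiset.prod_add, Multiset.prod_replicate]
  have hsum : (s.map primeWeight).sum = s.count 3 + (t.map primeWeight).sum := by
    conv_lhs => rw [← hdec]
    simp [primeWeight]
  rw [hprod, hsum]
  rcases h : s.count 3 with _ | a
  · rw [if_neg (Multiset.count_eq_zero.1 h), pow_zero, zero_add, add_zero]
    refine colorBound_hasColoring_mul_prod ?_ ?_ t hts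
    · simpa using colorBound_card (ZMod 1)
    · exact ⟨ZMod 1, id, fun a b _ _ _ h => absurd (Subsingleton.elim a b) h, by simp [Set.ncard_univ]⟩
  · rw [if_pos (Multiset.count_pos.1 (by omega)),
      show 1 + (a + 1 + (t.map primeWeight).sum) + 1 = a + 3 + (t.map primeWeight).sum by ring]
    exact colorBound_hasColoring_mul_prod (colorBound_three_pow a) (hasColoring_three_pow a) t hts

theorem hasRainbowSolution_iff {n r : ℕ} (c : ZMod n → Fin r) :
    HasRainbowSolution (sidonEquation n) c ↔ ¬ RainbowFree c := by
  constructor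
  · rintro ⟨x, hx, hinj⟩ hc
    have hne : ∀ i j, i ≠ j → c (x i) ≠ c (x j) := fun i j hij h => hij (hinj h)
    exact hc (x 0) (x 1) (x 2) (x 3) hx (hne _ _ (by decide)) (hne _ _ (by decide))
      (hne _ _ (by decide)) (hne _ _ (by decide)) (hne _ _ (by decide)) (hne _ _ (by decide))
  · intro h
    unfold RainbowFree at h
    push Not at h
    obtain ⟨a, b, x, y, h, h1, h2, h3, h4, h5, h6, -⟩ := h
    refine ⟨![a, b, x, y], by simpa [sidonEquation] using h, fun i j hij => ?_⟩
    fin_cases i <;> fin_cases j <;> first | rfl | (exfalso; simp at hij; grind)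

theorem rainbowNumber_sidonEquation {n r : ℕ} [NeZero n] (hr : 0 < r) (hb : ColorBound (ZMod n) r)
    (hc : HasColoring (ZMod n) r) : rainbowNumber n (sidonEquation n) = r + 1 := by
  have hmem : r + 1 ∈ {r : ℕ | 0 < r ∧ ∀ c : ZMod n → Fin r, Function.Surjective c →
      HasRainbowSolution (sidonEquation n) c} := by
    refine ⟨by omega, fun c hsurj => ?_⟩
    rw [hasRainbowSolution_iff]
    intro hfree
    have := hb _ c hfree
    rw [hsurj.range_eq, Set.ncard_univ, Nat.card_fin] at this
    omega
  refine le_antisymm (Nat.sInf_le hmem) (le_csInf ⟨_, hmem⟩ ?_)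
  rintro s ⟨hs, h⟩
  by_contra! hlt
  obtain ⟨κ, c, hfree, hrc⟩ := hc
  have : Fintype (Set.range c) := (Set.finite_range c).fintype
  have : NeZero s := ⟨hs.ne'⟩
  obtain ⟨e⟩ : Nonempty (Fin s ↪ Set.range c) := by
    apply Function.Embedding.nonempty_of_card_le
    rw [Fintype.card_fin, ← Nat.card_eq_fintype_card]
    exact (Nat.lt_succ_iff.1 hlt).trans hrc
  have hinv := Function.leftInverse_invFun
    (f := fun i => (e i : κ)) (Subtype.val_injective.comp e.injective)
  -- All colors outside the s chosen ones are merged into a chosen one, giving an exact rainbow-free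
  -- s-coloring.
  refine (hasRainbowSolution_iff _).1 (h (Function.invFun (fun i => (e i : κ)) ∘ c) fun i => ?_)
    (hfree.comp _)
  obtain ⟨x, hx⟩ := (e i).2
  exact ⟨x, by rw [Function.comp_apply, hx]; exact hinv i⟩

theorem rainbowNumber_prod (s : Multiset ℕ) (hs : ∀ q ∈ s, q.Prime) :
    rainbowNumber s.prod (sidonEquation s.prod)
      = 2 + (s.map primeWeight).sum + if 3 ∈ s then 1 else 0 := by
  have : NeZero s.prod := ⟨Multiset.prod_ne_zero fun h0 => (hs 0 h0).ne_zero rfl⟩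
  obtain ⟨h1, h2⟩ := colorBound_hasColoring_prod s hs
  rw [rainbowNumber_sidonEquation (by omega) h1 h2]
  omega

theorem theorem2 (n k : ℕ) (p : Fin k → ℕ) (hprime : ∀ i, (p i).Prime) (hmono : Monotone p)
    (hn : n = ∏ i, p i) (m : Fin k)
    (hm : IsLeast {i | 3 ≤ p i} m ∨ ((∀ i, p i < 3) ∧ IsGreatest Set.univ m)) :
    rainbowNumber (p m) (sidonEquation (p m)) + (Finset.univ.filter fun i => p i ≤ 3 ∧ i ≠ m).card
        + 2 * (Finset.univ.filter fun i => 5 ≤ p i ∧ i ≠ m).card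
      = rainbowNumber n (sidonEquation n) := by
  have h1 := rainbowNumber_prod {p m} (by simpa using hprime m)
  have h2 := rainbowNumber_prod (Finset.univ.val.map p) (by simpa using hprime)
  rw [Multiset.prod_singleton, Multiset.map_singleton, Multiset.sum_singleton] at h1
  have hprod : (Finset.univ.val.map p).prod = n := hn.symm
  have hsum : ((Finset.univ.val.map p).map primeWeight).sum = ∑ i, primeWeight (p i) := by
    rw [Multiset.map_map]; rfl
  rw [hprod, hsum] at h2
  -- By monotonicity p m is the least prime factor that is at least 3, so a factor 3 occurs only if
  -- p m = 3, and the corrections on both sides agree.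
  have h3 : (3 ∈ Finset.univ.val.map p) ↔ 3 ∈ ({p m} : Multiset ℕ) := by
    simp only [Multiset.mem_map, Finset.mem_val, Finset.mem_univ, true_and, Multiset.mem_singleton]
    refine ⟨?_, fun h => ⟨m, h.symm⟩⟩
    rintro ⟨i, hi⟩
    rcases hm with ⟨hm3, hmin⟩ | ⟨hlt, -⟩
    · have h4 : p m ≤ p i := hmono (hmin hi.ge)
      have h5 : 3 ≤ p m := hm3
      omega
    · have := hlt i
      omega
  have h4 : ∑ i ∈ Finset.univ.erase m, primeWeight (p i)
      = (Finset.univ.filter fun i => p i ≤ 3 ∧ i ≠ m).card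
        + 2 * (Finset.univ.filter fun i => 5 ≤ p i ∧ i ≠ m).card := by
    rw [Finset.card_filter, Finset.card_filter, Finset.mul_sum, ← Finset.sum_add_distrib,
      ← Finset.add_sum_erase _ _ (Finset.mem_univ m)]
    simp only [ne_eq, not_true_eq_false, and_false, if_false, mul_zero, add_zero, zero_add]
    refine Finset.sum_congr rfl fun i hi => ?_
    have hi' := Finset.ne_of_mem_erase hi
    have := five_le_of_prime (hprime i)
    unfold primeWeight
    split_ifs <;> grind
  rw [h1, h2, ← Finset.add_sum_erase _ _ (Finset.mem_univ m), h4]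
  simp only [h3]
  omega
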